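/- Let $0<a\le b\le 2$, $0<\alpha<2$ and $\lambda>0$, and let $t\mapsto H_t$ be a continuous function from $\mathbf{R}$ to $[a,b]$. Let $Z_\alpha$ be an independently scattered symmetric $\alpha$-stable random measure on $\mathbf{R}$ with Lebesgue control measure; that is, the stable integrals $I(f)=\int f\,dZ_\alpha$, $f\in L^\alpha(\mathbf{R})$, have finite-dimensional distributions given by $$\mathbf{E}\Big[e^{i\sum_{k=1}^n\theta_k I(f_k)}\Big]=\exp\Big\{-\int_{-\infty}^{\infty}\Big|\sum_{k=1}^n\theta_k f_k(x)\Big|^\alpha dx\Big\}.$$ Let $$X_{H_t,\alpha,\lambda}(t)=\int_{-\infty}^{\infty}\Big[e^{-\lambda(t-x)_+}(t-x)_+^{H_t-\frac1\alpha}-e^{-\lambda(-x)_+}(-x)_+^{H_t-\frac1\alpha}\Big]dZ_\alpha(x),\qquad t\in\mathbf{R},$$ where $(x)_+=\max\{x,0\}$ and $0^\gamma=0$ for all $\gamma\in\mathbf{R}$, be the linear tempered multifractional stable motion (LTmFSM). A real process $Y(t)$, $t\in \mathbf{R}$, on a probability space $(\Omega,\mathcal{F},\mathbf{P})$ is called separable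 if there are a countable set $T^*\subset\mathbf{R}$ and an event $\Omega_0\in\mathcal{F}$ with $\mathbf{P}(\Omega_0)=0$ such that for every closed $F\subset\mathbf{R}$, $$\{\omega: Y(t)\in F\ \ \forall t\in T^*\}\setminus\{\omega: Y(t)\in F\ \ \forall t\in\mathbf{R}\}\subset\Omega_0 .$$ If $H_t\alpha<1$ for all $t\in\mathbf{R}$, then for every separable version $Y$ of the LTmFSM (a process, possibly on another probability space, with the same finite-dimensional distributions; in particular any separable modification) and every nonempty open interval $(c,d)$, $-\infty\le c<d\le\infty$, $$\mathbf{P}\Big(\Big\{\omega:\ \sup_{t\in(c,d)}|Y(t,\omega)|=\infty\Big\}\Big)=1 .$$ -/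

import Mathlib

open MeasureTheory ProbabilityTheory

noncomputable section

/-- The power `(u)_+ ^ γ` of the positive part of `u`, with the convention `0 ^ γ = 0`
for every real `γ` (also for `γ = 0`). -/
def posPartPow (u γ : ℝ) : ℝ := if 0 < u then u ^ γ else 0

/-- The kernel
`G(t, x) = e^{-lam (t-x)_+} (t-x)_+^{H_t - 1/α} - e^{-lam (-x)_+} (-x)_+^{H_t - 1/α}`. -/
def ltmfsmKernel (H : ℝ → ℝ) (α lam t x : ℝ) : ℝ :=
  Real.exp (-lam * max (t - x) 0) * posPartPow (t - x) (H t - 1 / α)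
    - Real.exp (-lam * max (-x) 0) * posPartPow (-x) (H t - 1 / α)

/-- `I` is the stable stochastic integral `I f = ∫ f dZ` with respect to a symmetric `α`-stable
(independently scattered) random measure `Z` on `ℝ` with Lebesgue control measure. As usual it is
the stochastic process indexed by the functions `f` in `L^α(ℝ)` whose finite-dimensional
distributions are given by the characteristic functions
`E exp (i ∑ θ_k I(f_k)) = exp (- ∫ |∑ θ_k f_k(x)|^α dx)`; the random measure is `Z A = I(1_A)`.
The value of `I` at a function outside `L^α(ℝ)` plays no role. -/
structure IsStableIntegral {Ω : Type*} [MeasurableSpace Ω] (P : Measure Ω) (α : ℝ)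
    (I : (ℝ → ℝ) → Ω → ℝ) : Prop where
  measurable : ∀ f : ℝ → ℝ, MemLp f (ENNReal.ofReal α) volume → Measurable (I f)
  charFun_eq : ∀ (n : ℕ) (f : Fin n → ℝ → ℝ),
    (∀ k, MemLp (f k) (ENNReal.ofReal α) volume) → ∀ θ : Fin n → ℝ,
      ∫ ω, Complex.exp (Complex.I * ((∑ k, θ k * I (f k) ω : ℝ) : ℂ)) ∂P
        = ((Real.exp (-∫ x, |∑ k, θ k * f k x| ^ α) : ℝ) : ℂ)

/-- The linear tempered multifractional stable motion `X(t) = ∫ G(t, x) dZ(x)`, where `I` is the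
integral with respect to the stable random measure `Z`. -/
def ltmfsm {Ω : Type*} (I : (ℝ → ℝ) → Ω → ℝ) (H : ℝ → ℝ) (α lam : ℝ) (t : ℝ) : Ω → ℝ :=
  I (ltmfsmKernel H α lam t)

/-- `Y` is a version of `X`: the two processes, which may live on different probability spaces,
have the same finite-dimensional distributions. In particular this covers every modification of
`X`, that is, every `Y` on the same space with `Y t = X t` almost surely for each `t`. -/
def IsVersion {T Ω Ω' : Type*} [MeasurableSpace Ω] [MeasurableSpace Ω']
    (Y : T → Ω' → ℝ) (P' : Measure Ω') (X : T → Ω → ℝ) (P : Measure Ω) : Prop :=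
  ∀ (n : ℕ) (t : Fin n → T),
    IdentDistrib (fun ω (k : Fin n) => Y (t k) ω) (fun ω (k : Fin n) => X (t k) ω) P' P

/-- A separable process: there are a countable set `S` of times and a null event `N` such that,
for every closed `F`, outside `N` the path stays in `F` at all times as soon as it stays in `F` at
the times in `S`. -/
def IsSeparableProcess {T Ω : Type*} [MeasurableSpace Ω] (X : T → Ω → ℝ) (P : Measure Ω) : Prop :=
  ∃ S : Set T, S.Countable ∧ ∃ N : Set Ω, MeasurableSet N ∧ P N = 0 ∧
    ∀ F : Set ℝ, IsClosed F →
      {ω | ∀ t ∈ S, X t ω ∈ F} \ {ω | ∀ t : T, X t ω ∈ F} ⊆ N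

end

/-! Since `H t * α < 1`, the exponent `H t - 1/α` is negative, and the kernel `G(t, x)` blows up as
`t` decreases to `x`. Along a sequence `t k` dense in a bounded interval, the functions `f k = G(t
k, ·)` are thus unbounded at every point of the interval. This forces the integrals `I (f k)` to be
almost surely unbounded when `α < 2`.

Positive probability: fix a level `u` and split the interval into sets `A k` on which `k` is the
first index with `|f k| > u`. The restrictions `g k` of `f k` to `A k` have disjoint supports, so
the `I (g k)` are independent, and `∫ |g k|^α ≥ u^α |A k|`. The stable tail at `u` has order at
least `σ / u^α` when this is small, so `u` cancels and some `|I (g k)|` exceeds `u` with probability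
bounded below uniformly in `u` (`measureReal_exists_abs_gt_ge`). A reflection argument passes from
the `g k` to the `f k` at the cost of a factor 2 (`measureReal_exists_restrict_le`).

Probability one: boundedness defines a measurable subspace of sequences, and a stable law gives such
a subspace mass 0 or 1 (`measure_submodule_eq_zero_or_one`). Only the law of a countable family
enters, so the result passes to `Y`. -/

/-! ### Joint laws and the stability property -/

/-- The characteristic function of the joint law of finitely many random variables. -/
lemma charFunDual_map_fun {ι Ω : Type*} [Fintype ι] [DecidableEq ι] [MeasurableSpace Ω]
    {P : Measure Ω} {Z : ι → Ω → ℝ} (hZ : ∀ i, Measurable (Z i)) (L : StrongDual ℝ (ι → ℝ)) :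
    charFunDual (P.map (fun ω i => Z i ω)) L
      = ∫ ω, Complex.exp (Complex.I * ((∑ i, L (Pi.single i 1) * Z i ω : ℝ) : ℂ)) ∂P := by
  rw [charFunDual_apply, integral_map (measurable_pi_lambda _ hZ).aemeasurable (by fun_prop)]
  congr with ω
  have : L (fun i => Z i ω) = ∑ i, L (Pi.single i 1) * Z i ω := by
    conv_lhs => rw [pi_eq_sum_univ' (fun i => Z i ω)]
    simp only [map_sum, map_smul, smul_eq_mul]
    refine Finset.sum_congr rfl fun i _ => ?_
    rw [mul_comm]
  rw [this, mul_comm]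

/-- Two finite families of random variables whose joint characteristic functions agree have the
same joint law. -/
lemma map_eq_of_charFun_eq {ι Ω₁ Ω₂ : Type*} [Fintype ι] [MeasurableSpace Ω₁] [MeasurableSpace Ω₂]
    {P₁ : Measure Ω₁} {P₂ : Measure Ω₂} [IsFiniteMeasure P₁] [IsFiniteMeasure P₂]
    {Z : ι → Ω₁ → ℝ} {W : ι → Ω₂ → ℝ} (hZ : ∀ i, Measurable (Z i)) (hW : ∀ i, Measurable (W i))
    (h : ∀ θ : ι → ℝ, ∫ ω, Complex.exp (Complex.I * ((∑ i, θ i * Z i ω : ℝ) : ℂ)) ∂P₁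
      = ∫ ω, Complex.exp (Complex.I * ((∑ i, θ i * W i ω : ℝ) : ℂ)) ∂P₂) :
    P₁.map (fun ω i => Z i ω) = P₂.map (fun ω i => W i ω) := by
  classical
  refine Measure.ext_of_charFunDual (funext fun L => ?_)
  rw [charFunDual_map_fun hZ, charFunDual_map_fun hW, h]

namespace IsStableIntegral

variable {Ω : Type*} [MeasurableSpace Ω] {P : Measure Ω} {α : ℝ} {I : (ℝ → ℝ) → Ω → ℝ}

lemma charFun_fintype (hI : IsStableIntegral P α I) {ι : Type*} [Fintype ι] {f : ι → ℝ → ℝ}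
    (hf : ∀ k, MemLp (f k) (ENNReal.ofReal α) volume) (θ : ι → ℝ) :
    ∫ ω, Complex.exp (Complex.I * ((∑ k, θ k * I (f k) ω : ℝ) : ℂ)) ∂P
      = ((Real.exp (-∫ x, |∑ k, θ k * f k x| ^ α) : ℝ) : ℂ) := by
  have e := (Fintype.equivFin ι).symm
  have := hI.charFun_eq _ (f ∘ e) (fun k => hf _) (θ ∘ e)
  have e1 : ∀ ω, ∑ k, θ (e k) * I (f (e k)) ω = ∑ k, θ k * I (f k) ω := fun ω =>
    e.sum_comp fun k => θ k * I (f k) ω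
  have e2 : ∀ x, ∑ k, θ (e k) * f (e k) x = ∑ k, θ k * f k x := fun x =>
    e.sum_comp fun k => θ k * f k x
  simpa only [Function.comp_apply, e1, e2] using this

/-- The characteristic function of a single stable integral. -/
lemma integral_cos (hI : IsStableIntegral P α I) {f : ℝ → ℝ}
    (hf : MemLp f (ENNReal.ofReal α) volume) (θ : ℝ) :
    ∫ ω, Real.cos (θ * I f ω) ∂P = Real.exp (-(|θ| ^ α * ∫ x, |f x| ^ α)) := by
  have h := hI.charFun_fintype (ι := Unit) (fun _ => hf) (fun _ => θ)
  have h' := congrArg Complex.re h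
  simp only [Finset.univ_unique, Finset.sum_singleton, Complex.ofReal_re] at h'
  simp_rw [abs_mul, Real.mul_rpow (abs_nonneg _) (abs_nonneg _), integral_const_mul] at h'
  rw [← h', ← Complex.reCLM_apply, ← ContinuousLinearMap.integral_comp_comm]
  · congr with ω
    rw [Complex.reCLM_apply, mul_comm Complex.I, Complex.exp_ofReal_mul_I_re]
  -- A nonintegrable function has integral 0 by convention, whereas the characteristic function
  -- never vanishes.
  · by_contra hn
    simp only [Finset.univ_unique, Finset.sum_singleton] at h
    rw [integral_undef hn] at h
    exact (Complex.ofReal_ne_zero.2 (Real.exp_pos _).ne') h.symm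

/-- Stability: `r X' + s X''` has the law of `X` when `X'`, `X''` are independent copies of `X`
and `r ^ α + s ^ α = 1`. -/
lemma map_add_prod (hI : IsStableIntegral P α I) [IsProbabilityMeasure P] {f : ℕ → ℝ → ℝ}
    (hf : ∀ k, MemLp (f k) (ENNReal.ofReal α) volume) {r s : ℝ} (hr : 0 ≤ r) (hs : 0 ≤ s)
    (hrs : r ^ α + s ^ α = 1) :
    (P.prod P).map (fun p k => r * I (f k) p.1 + s * I (f k) p.2)
      = P.map (fun ω k => I (f k) ω) := by
  have hm := fun k => hI.measurable _ (hf k)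
  have h1 : P.map (fun ω k => I (f k) ω)
      = (P.prod P).map (fun (p : Ω × Ω) k => I (f k) p.1) := by
    rw [← (measurePreserving_fst (μ := P) (ν := P)).map_eq, Measure.map_map]
    · rw [(measurePreserving_fst (μ := P) (ν := P)).map_eq]; rfl
    · fun_prop
    · fun_prop
  -- The law of a sequence is determined by its finite marginals, hence by their characteristic
  -- functions.
  rw [h1, map_eq_iff_forall_finset_map_restrict_eq (X := fun k (p : Ω × Ω) =>
    r * I (f k) p.1 + s * I (f k) p.2) (Y := fun k (p : Ω × Ω) => I (f k) p.1)
    (by fun_prop) (by fun_prop)]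
  intro J
  refine map_eq_of_charFun_eq (Z := fun (k : J) (p : Ω × Ω) =>
    r * I (f k) p.1 + s * I (f k) p.2) (W := fun (k : J) (p : Ω × Ω) => I (f k) p.1)
    (by fun_prop) (by fun_prop) fun θ => ?_
  have scale : ∀ q : ℝ, 0 ≤ q →
      ∫ ω, Complex.exp (Complex.I * ((∑ k : J, (q * θ k) * I (f k) ω : ℝ) : ℂ)) ∂P
        = ((Real.exp (-(q ^ α * ∫ x, |∑ k : J, θ k * f k x| ^ α)) : ℝ) : ℂ) := by
    intro q hq
    rw [hI.charFun_fintype (fun k : J => hf k)]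
    simp_rw [mul_assoc, ← Finset.mul_sum, abs_mul, Real.mul_rpow (abs_nonneg _) (abs_nonneg _),
      integral_const_mul, abs_of_nonneg hq]
  have hR : ∫ p, Complex.exp (Complex.I * ((∑ k : J, θ k * I (f k) p.1 : ℝ) : ℂ)) ∂(P.prod P)
      = ∫ ω, Complex.exp (Complex.I * ((∑ k : J, θ k * I (f k) ω : ℝ) : ℂ)) ∂P := by
    rw [integral_fun_fst (μ := P) (ν := P)
      (fun ω => Complex.exp (Complex.I * ((∑ k : J, θ k * I (f k) ω : ℝ) : ℂ)))]
    simp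
  rw [hR, hI.charFun_fintype (fun k : J => hf k)]
  calc _ = ∫ p : Ω × Ω, Complex.exp (Complex.I * ((∑ k : J, (r * θ k) * I (f k) p.1 : ℝ) : ℂ))
          * Complex.exp (Complex.I * ((∑ k : J, (s * θ k) * I (f k) p.2 : ℝ) : ℂ)) ∂(P.prod P) := by
        congr with p
        rw [← Complex.exp_add, ← mul_add, ← Complex.ofReal_add, ← Finset.sum_add_distrib]
        congr 3
        exact Finset.sum_congr rfl fun k _ => by ring
    _ = _ := by
        rw [integral_prod_mul
          (fun ω => Complex.exp (Complex.I * ((∑ k : J, (r * θ k) * I (f k) ω : ℝ) : ℂ)))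
          (fun ω => Complex.exp (Complex.I * ((∑ k : J, (s * θ k) * I (f k) ω : ℝ) : ℂ))),
          scale r hr, scale s hs, ← Complex.ofReal_mul, ← Real.exp_add]
        congr 2
        linear_combination -(∫ x, |∑ k : J, θ k * f k x| ^ α) * hrs

end IsStableIntegral

/-! ### Zero-one law for measurable subspaces -/

/-- The sequences that are bounded. -/
def boundedSeqs : Submodule ℝ (ℕ → ℝ) where
  carrier := {v | ∃ M : ℕ, ∀ k, |v k| ≤ M}
  zero_mem' := ⟨0, by simp⟩
  add_mem' := by
    rintro v w ⟨M, hM⟩ ⟨N, hN⟩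
    refine ⟨M + N, fun k => (abs_add_le _ _).trans ?_⟩
    push_cast
    exact add_le_add (hM k) (hN k)
  smul_mem' := by
    rintro c v ⟨M, hM⟩
    refine ⟨⌈|c| * M⌉₊, fun k => ?_⟩
    rw [Pi.smul_apply, smul_eq_mul, abs_mul]
    exact (mul_le_mul_of_nonneg_left (hM k) (abs_nonneg c)).trans (Nat.le_ceil _)

lemma mem_boundedSeqs {v : ℕ → ℝ} : v ∈ boundedSeqs ↔ ∃ M : ℕ, ∀ k, |v k| ≤ M := Iff.rfl

lemma measurableSet_boundedSeqs : MeasurableSet (boundedSeqs : Set (ℕ → ℝ)) := by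
  have : (boundedSeqs : Set (ℕ → ℝ)) = ⋃ M : ℕ, ⋂ k, {v : ℕ → ℝ | |v k| ≤ M} := by
    ext v
    simp only [SetLike.mem_coe, mem_boundedSeqs, Set.mem_iUnion, Set.mem_iInter, Set.mem_ofPred_eq]
  rw [this]
  refine .iUnion fun M => .iInter fun k => measurableSet_le (by fun_prop) (by fun_prop)

/-- Zero-one law: if a random vector `X` has the law of `r m • X' + s m • X''`, with `X'`, `X''`
independent copies of `X`, for infinitely many non-proportional pairs `(r m, s m)`, then `X`
belongs to a measurable subspace with probability zero or one. -/
lemma measure_submodule_eq_zero_or_one {E : Type*} [AddCommGroup E] [Module ℝ E]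
    [MeasurableSpace E] (μ : Measure E) [IsProbabilityMeasure μ] (V : Submodule ℝ E)
    (hV : MeasurableSet (V : Set E)) (r s : ℕ → ℝ)
    (hm : ∀ m, Measurable (fun p : E × E => r m • p.1 + s m • p.2))
    (hlaw : ∀ m, (μ.prod μ).map (fun p : E × E => r m • p.1 + s m • p.2) = μ)
    (hne : ∀ m n, m ≠ n → r m * s n - r n * s m ≠ 0) :
    μ V = 0 ∨ μ V = 1 := by
  have hVV : MeasurableSet ((V : Set E) ×ˢ (V : Set E)) := hV.prod hV
  -- Two non-proportional combinations of `x` and `y` lying in `V` put both `x` and `y` in `V`, so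
  -- these events are disjoint. Each has probability `p - p²` with `p = μ V`; as there are
  -- infinitely many, `p = p²`.
  let A : ℕ → Set (E × E) := fun m =>
    (fun p : E × E => r m • p.1 + s m • p.2) ⁻¹' V \ ((V : Set E) ×ˢ (V : Set E))
  have hA : ∀ m, MeasurableSet (A m) := fun m => (hm m hV).diff hVV
  have hdisj : Pairwise (Function.onFun Disjoint A) := by
    intro m n hmn
    refine Set.disjoint_left.2 ?_
    rintro ⟨x, y⟩ ⟨h1, h2⟩ ⟨h3, -⟩
    simp only [Set.mem_preimage, SetLike.mem_coe] at h1 h3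
    refine h2 ⟨?_, ?_⟩
    · have : (r m * s n - r n * s m) • x ∈ V := by
        have := V.sub_mem (V.smul_mem (s n) h1) (V.smul_mem (s m) h3)
        convert this using 1
        module
      exact (V.smul_mem_iff (hne m n hmn)).1 this
    · have : (r m * s n - r n * s m) • y ∈ V := by
        have := V.sub_mem (V.smul_mem (r m) h3) (V.smul_mem (r n) h1)
        convert this using 1
        module
      exact (V.smul_mem_iff (hne m n hmn)).1 this
  have hsplit : ∀ m, μ V = (μ.prod μ) (A m) + μ V * μ V := by
    intro m
    have h1 : (μ.prod μ) ((fun p : E × E => r m • p.1 + s m • p.2) ⁻¹' V) = μ V := by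
      rw [← Measure.map_apply (hm m) hV, hlaw m]
    rw [← Measure.prod_prod, ← h1]
    refine (measure_sdiff_add_inter _ hVV).symm.trans ?_
    congr 2
    refine Set.inter_eq_right.2 ?_
    rintro ⟨x, y⟩ ⟨hx, hy⟩
    exact V.add_mem (V.smul_mem _ hx) (V.smul_mem _ hy)
  have hfin : μ V * μ V ≠ ⊤ := ENNReal.mul_ne_top (measure_ne_top _ _) (measure_ne_top _ _)
  have hconst : ∀ m, (μ.prod μ) (A m) = (μ.prod μ) (A 0) := fun m =>
    (ENNReal.add_left_inj hfin).1 ((hsplit m).symm.trans (hsplit 0))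
  have hzero : (μ.prod μ) (A 0) = 0 := by
    by_contra h0
    have h1 := measure_iUnion (μ := μ.prod μ) hdisj hA
    simp_rw [hconst] at h1
    rw [ENNReal.tsum_const_eq_top_of_ne_zero h0] at h1
    exact measure_ne_top _ _ h1
  have hp := hsplit 0
  rw [hzero, zero_add] at hp
  by_cases h0 : μ V = 0
  · exact .inl h0
  · right
    have : μ V * μ V = μ V * 1 := by rw [mul_one, ← hp]
    exact (ENNReal.mul_right_inj h0 (measure_ne_top _ _)).1 this

/-- A sequence of stable integrals is bounded with probability zero or one. -/
lemma IsStableIntegral.measure_bounded_eq_zero_or_one {Ω : Type*} [MeasurableSpace Ω]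
    {P : Measure Ω} [IsProbabilityMeasure P] {α : ℝ} (hα : 0 < α) {I : (ℝ → ℝ) → Ω → ℝ}
    (hI : IsStableIntegral P α I) {f : ℕ → ℝ → ℝ}
    (hf : ∀ k, MemLp (f k) (ENNReal.ofReal α) volume) :
    P {ω | (fun k => I (f k) ω) ∈ boundedSeqs} = 0
      ∨ P {ω | (fun k => I (f k) ω) ∈ boundedSeqs} = 1 := by
  have hX : Measurable (fun ω k => I (f k) ω) :=
    measurable_pi_lambda _ fun k => hI.measurable _ (hf k)
  have hprob : IsProbabilityMeasure (P.map (fun ω k => I (f k) ω)) :=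
    Measure.isProbabilityMeasure_map hX.aemeasurable
  -- Any sequence of distinct points of `(0, 1)` would do: the weights `t^(1/α)` and `(1 - t)^(1/α)`
  -- have `α`-th powers summing to 1, and proportional pairs force equal `t`.
  let t : ℕ → ℝ := fun m => 1 / ((m : ℝ) + 2)
  have ht0 : ∀ m, 0 < t m := fun m => by positivity
  have ht1 : ∀ m, 0 < 1 - t m := fun m => by
    have : t m < 1 := by
      rw [div_lt_one (by positivity)]
      have : (0 : ℝ) ≤ m := m.cast_nonneg
      linarith
    linarith
  have h := measure_submodule_eq_zero_or_one (P.map (fun ω k => I (f k) ω)) boundedSeqs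
    measurableSet_boundedSeqs (fun m => t m ^ (1 / α)) (fun m => (1 - t m) ^ (1 / α))
    (fun m => by fun_prop) ?_ ?_
  · rwa [Measure.map_apply hX measurableSet_boundedSeqs] at h
  · intro m
    rw [Measure.map_prod_map _ _ hX hX, Measure.map_map (by fun_prop) (hX.prodMap hX)]
    exact hI.map_add_prod hf (Real.rpow_nonneg (ht0 m).le _) (Real.rpow_nonneg (ht1 m).le _)
      (by rw [← Real.rpow_mul (ht0 m).le, ← Real.rpow_mul (ht1 m).le, one_div_mul_cancel hα.ne',
        Real.rpow_one, Real.rpow_one]; ring)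
  · intro m n hmn h0
    rw [sub_eq_zero, ← Real.mul_rpow (ht0 m).le (ht1 n).le,
      ← Real.mul_rpow (ht0 n).le (ht1 m).le,
      Real.rpow_left_inj (mul_pos (ht0 m) (ht1 n)).le (mul_pos (ht0 n) (ht1 m)).le
        (by positivity)] at h0
    have h1 : t m = t n := by linarith
    simp only [t, one_div, inv_inj, add_left_inj, Nat.cast_inj] at h1
    exact hmn h1

/-! ### Lower bounds for stable tails -/

/-- The factor 2 is the ratio of the bounds `1 - cos (r y) ≤ r² y² / 2` and `1 - cos y ≥ y² / 4`,
the latter valid for `|y| ≤ 1`. -/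
lemma one_sub_cos_mul_le {r y : ℝ} (hy : |y| ≤ 1) :
    1 - Real.cos (r * y) ≤ 2 * r ^ 2 * (1 - Real.cos y) := by
  have h1 := Real.one_sub_sq_div_two_le_cos (x := r * y)
  have h2 := (abs_le.1 (Real.cos_bound hy)).2
  have h3 : |y| ^ 4 ≤ y ^ 2 := by
    rw [← sq_abs y]
    exact pow_le_pow_of_le_one (abs_nonneg y) hy (by norm_num)
  have h4 : y ^ 2 / 4 ≤ 1 - Real.cos y := by nlinarith [sq_nonneg y]
  nlinarith [sq_nonneg r, sq_nonneg y, mul_le_mul_of_nonneg_left h4 (sq_nonneg r)]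

lemma mul_one_sub_exp_neg_le {r x : ℝ} (hr0 : 0 ≤ r) (hr1 : r ≤ 1) :
    r * (1 - Real.exp (-x)) ≤ 1 - Real.exp (-(r * x)) := by
  have h := convexOn_exp.2 (Set.mem_univ (-x)) (Set.mem_univ 0) hr0 (sub_nonneg.2 hr1) (by ring)
  simp only [smul_eq_mul, mul_zero, add_zero, Real.exp_zero, mul_one, mul_neg] at h
  linarith

/-- Induction from `1 - p q ≤ (1 - p) + (1 - q)` for `p, q ≤ 1`. It makes the tail bound for a
family depend only on the sum of the scales. -/
lemma one_sub_exp_neg_sum_le {ι : Type*} (s : Finset ι) {x : ι → ℝ} (hx : ∀ i, 0 ≤ x i) :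
    1 - Real.exp (-∑ i ∈ s, x i) ≤ ∑ i ∈ s, (1 - Real.exp (-x i)) := by
  classical
  induction s using Finset.induction_on with
  | empty => simp
  | insert i s hi ih =>
    rw [Finset.sum_insert hi, Finset.sum_insert hi, neg_add, Real.exp_add]
    have h1 : Real.exp (-x i) ≤ 1 := Real.exp_le_one_iff.2 (by linarith [hx i])
    have h2 : Real.exp (-∑ i ∈ s, x i) ≤ 1 :=
      Real.exp_le_one_iff.2 (by linarith [Finset.sum_nonneg fun i (_ : i ∈ s) => hx i])
    nlinarith

/-- The constant in the lower bound for the tail of a symmetric `α`-stable variable. -/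
noncomputable def stableTailConst (α : ℝ) : ℝ := ((1 / 4 : ℝ) ^ (1 / (2 - α))) ^ α / 4

lemma stableTailConst_pos (α : ℝ) : 0 < stableTailConst α := by
  unfold stableTailConst
  positivity

/-- A lower bound for the tail of a symmetric `α`-stable variable, `α < 2`. -/
lemma measureReal_abs_gt_ge_of_integral_cos {Ω : Type*} [MeasurableSpace Ω] {P : Measure Ω}
    [IsProbabilityMeasure P] {α σ u : ℝ} (hα : 0 < α) (hα2 : α < 2) (hu : 0 < u) {w : Ω → ℝ}
    (hw : Measurable w)
    (hcos : ∀ θ : ℝ, ∫ ω, Real.cos (θ * w ω) ∂P = Real.exp (-(|θ| ^ α * σ))) :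
    stableTailConst α * (1 - Real.exp (-(σ / u ^ α))) ≤ P.real {ω | u < |w ω|} := by
  -- Chosen so that `2 r² = r^α / 2`: the quadratic error at frequency `r / u` absorbs only half of
  -- the main term `r^α`. This is where `α < 2` enters.
  let r : ℝ := (1 / 4 : ℝ) ^ (1 / (2 - α))
  have hr : 0 < r := by positivity
  have hr1 : r ≤ 1 := Real.rpow_le_one (by norm_num) (by norm_num)
    (one_div_nonneg.2 (by linarith))
  have hr2 : r ^ 2 = r ^ α / 4 := by
    have h1 : r ^ (2 - α) = 1 / 4 := by
      rw [← Real.rpow_mul (by norm_num), one_div_mul_cancel (by linarith), Real.rpow_one]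
    have h2 : r ^ (2 : ℝ) = r ^ α * r ^ (2 - α) := by
      rw [← Real.rpow_add hr]; congr 1; ring
    rw [← Real.rpow_natCast, Nat.cast_ofNat, h2, h1]; ring
  have hint : ∀ θ : ℝ, Integrable (fun ω => Real.cos (θ * w ω)) P := fun θ =>
    Integrable.of_bound (by fun_prop) 1 (.of_forall fun ω => Real.abs_cos_le_one _)
  have hint' : ∀ θ : ℝ, Integrable (fun ω => 1 - Real.cos (θ * w ω)) P := fun θ =>
    (integrable_const _).sub (hint θ)
  have hS : MeasurableSet {ω | u < |w ω|} := measurableSet_lt (by fun_prop) (by fun_prop)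
  have hval : ∀ q : ℝ, 0 < q →
      ∫ ω, (1 - Real.cos (q / u * w ω)) ∂P = 1 - Real.exp (-(q ^ α * (σ / u ^ α))) := by
    intro q hq
    rw [integral_sub (integrable_const _) (hint _), hcos, abs_of_pos (by positivity),
      Real.div_rpow hq.le hu.le]
    simp only [integral_const, probReal_univ, smul_eq_mul, mul_one]
    congr 3
    ring
  -- Where `|w| ≤ u` the cosine comparison applies; elsewhere the left side is at most 2.
  have hpt : ∀ ω, 1 - Real.cos (r / u * w ω)
      ≤ {ω | u < |w ω|}.indicator (fun _ => (2 : ℝ)) ω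
        + 2 * r ^ 2 * (1 - Real.cos (1 / u * w ω)) := by
    intro ω
    by_cases h : u < |w ω|
    · rw [Set.indicator_of_mem (by exact h)]
      have h1 := Real.neg_one_le_cos (r / u * w ω)
      have h2 := Real.cos_le_one (1 / u * w ω)
      have : 0 ≤ 2 * r ^ 2 * (1 - Real.cos (1 / u * w ω)) :=
        mul_nonneg (by positivity) (by linarith)
      linarith
    · rw [Set.indicator_of_notMem (by exact h), zero_add]
      have := one_sub_cos_mul_le (r := r) (y := 1 / u * w ω) (by
        rw [abs_mul, abs_of_pos (by positivity), one_div_mul_eq_div]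
        exact (div_le_one hu).2 (not_lt.1 h))
      rwa [show r / u * w ω = r * (1 / u * w ω) by ring]
  have hmain := integral_mono (μ := P) (hint' (r / u))
    (((integrable_const (2 : ℝ)).indicator hS).add ((hint' (1 / u)).const_mul (2 * r ^ 2))) hpt
  simp only [Pi.add_apply] at hmain
  rw [integral_add ((integrable_const (2 : ℝ)).indicator hS)
      ((hint' (1 / u)).const_mul (2 * r ^ 2)),
    integral_const_mul, integral_indicator_const _ hS, hval r hr, hval 1 one_pos,
    Real.one_rpow, one_mul, smul_eq_mul] at hmain
  have hconv := mul_one_sub_exp_neg_le (r := r ^ α) (x := σ / u ^ α) (by positivity)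
    (Real.rpow_le_one hr.le hr1 hα.le)
  have hc : stableTailConst α = r ^ α / 4 := rfl
  rw [hr2] at hmain
  rw [hc]
  linarith

/-- The stable tail bound for a finite independent family, uniform in the number of variables. -/
lemma measureReal_exists_abs_gt_ge {Ω : Type*} [MeasurableSpace Ω] {P : Measure Ω}
    [IsProbabilityMeasure P] {α u : ℝ} (hα : 0 < α) (hα2 : α < 2) (hu : 0 < u) {n : ℕ}
    {σ : Fin n → ℝ} (hσ : ∀ i, 0 ≤ σ i) {w : Fin n → Ω → ℝ}
    (hw : ∀ i, Measurable (w i)) (hind : iIndepFun w P)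
    (hcos : ∀ i, ∀ θ : ℝ, ∫ ω, Real.cos (θ * w i ω) ∂P = Real.exp (-(|θ| ^ α * σ i))) :
    1 - Real.exp (-(stableTailConst α * (1 - Real.exp (-∑ i, σ i / u ^ α))))
      ≤ P.real {ω | ∃ i, u < |w i ω|} := by
  have hmeas : ∀ i, MeasurableSet {ω | u < |w i ω|} := fun i =>
    measurableSet_lt (by fun_prop) (by fun_prop)
  have hcompl : {ω | ∃ i, u < |w i ω|}ᶜ = ⋂ i ∈ Finset.univ, w i ⁻¹' {x | |x| ≤ u} := by
    ext ω; simp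
  have hmeasE : MeasurableSet {ω | ∃ i, u < |w i ω|} := by
    have : {ω | ∃ i, u < |w i ω|} = ⋃ i, {ω | u < |w i ω|} := by ext; simp
    rw [this]
    exact .iUnion hmeas
  have hprod : P.real {ω | ∃ i, u < |w i ω|}ᶜ = ∏ i, P.real (w i ⁻¹' {x | |x| ≤ u}) := by
    rw [hcompl, measureReal_def, hind.measure_inter_preimage_eq_mul Finset.univ
      (fun i _ => measurableSet_le (by fun_prop) (by fun_prop)), ENNReal.toReal_prod]
    rfl
  have hfac : ∀ i, P.real (w i ⁻¹' {x | |x| ≤ u})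
      ≤ Real.exp (-(stableTailConst α * (1 - Real.exp (-(σ i / u ^ α))))) := by
    intro i
    have h1 : w i ⁻¹' {x | |x| ≤ u} = {ω | u < |w i ω|}ᶜ := by ext; simp
    rw [h1, probReal_compl_eq_one_sub (hmeas i)]
    have h2 := measureReal_abs_gt_ge_of_integral_cos hα hα2 hu (hw i) (hcos i)
    refine le_trans ?_ (Real.one_sub_le_exp_neg _)
    linarith
  have h3 : P.real {ω | ∃ i, u < |w i ω|}ᶜ
      ≤ Real.exp (-(stableTailConst α * (1 - Real.exp (-∑ i, σ i / u ^ α)))) := by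
    rw [hprod]
    refine (Finset.prod_le_prod (fun i _ => measureReal_nonneg) fun i _ => hfac i).trans ?_
    rw [← Real.exp_sum, Real.exp_le_exp, Finset.sum_neg_distrib, ← Finset.mul_sum, neg_le_neg_iff]
    exact mul_le_mul_of_nonneg_left (one_sub_exp_neg_sum_le _ fun i =>
      div_nonneg (hσ i) (Real.rpow_nonneg hu.le _)) (stableTailConst_pos α).le
  rw [probReal_compl_eq_one_sub hmeasE] at h3
  linarith

/-! ### Disjoint supports: independence and the maximal inequality -/

lemma memLp_integrable_abs_rpow {α : ℝ} (hα : 0 < α) {f : ℝ → ℝ}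
    (hf : MemLp f (ENNReal.ofReal α) volume) : Integrable (fun x => |f x| ^ α) := by
  have := hf.integrable_norm_rpow (by simpa using hα) ENNReal.ofReal_ne_top
  simpa only [ENNReal.toReal_ofReal hα.le, Real.norm_eq_abs] using this

namespace IsStableIntegral

variable {Ω : Type*} [MeasurableSpace Ω] {P : Measure Ω} {α : ℝ} {I : (ℝ → ℝ) → Ω → ℝ}

/-- Stable integrals of disjointly supported functions are independent. -/
lemma iIndepFun_of_disjoint (hI : IsStableIntegral P α I) [IsProbabilityMeasure P] (hα : 0 < α)
    {n : ℕ} {g : Fin n → ℝ → ℝ} (hg : ∀ k, MemLp (g k) (ENNReal.ofReal α) volume)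
    (hdisj : ∀ x i j, i ≠ j → g i x = 0 ∨ g j x = 0) :
    iIndepFun (fun k => I (g k)) P := by
  have hm := fun k => hI.measurable _ (hg k)
  rw [iIndepFun_iff_charFun_pi fun k => (hm k).aemeasurable]
  intro t
  -- At most one term is nonzero at each `x`, so the characteristic exponent is additive and the
  -- joint characteristic function factors.
  have hpt : ∀ x, |∑ k, t k * g k x| ^ α = ∑ k, |t k| ^ α * |g k x| ^ α := by
    intro x
    by_cases h : ∃ k, g k x ≠ 0
    · obtain ⟨k, hk⟩ := h
      have h0 : ∀ i, i ≠ k → g i x = 0 := fun i hi => (hdisj x i k hi).resolve_right hk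
      rw [Finset.sum_eq_single k (fun i _ hi => by rw [h0 i hi, mul_zero]) (by simp),
        Finset.sum_eq_single k (fun i _ hi => by
          rw [h0 i hi, abs_zero, Real.zero_rpow hα.ne', mul_zero]) (by simp),
        abs_mul, Real.mul_rpow (abs_nonneg _) (abs_nonneg _)]
    · push Not at h
      simp [h, Real.zero_rpow hα.ne']
  have hone : ∀ k, charFun (P.map (I (g k))) (t k)
      = ((Real.exp (-(|t k| ^ α * ∫ x, |g k x| ^ α)) : ℝ) : ℂ) := by
    intro k
    have := hI.charFun_fintype (ι := Unit) (fun _ => hg k) (fun _ => t k)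
    simp only [Finset.univ_unique, Finset.sum_singleton, abs_mul,
      Real.mul_rpow (abs_nonneg _) (abs_nonneg _), integral_const_mul] at this
    rw [charFun_apply_real, integral_map (hm k).aemeasurable (by fun_prop), ← this]
    congr with ω
    rw [mul_comm Complex.I]
    push_cast
    rfl
  rw [charFun_apply, integral_map (by fun_prop) (by fun_prop)]
  simp_rw [hone]
  rw [← Complex.ofReal_prod, ← Real.exp_sum, Finset.sum_neg_distrib]
  have := hI.charFun_fintype hg t
  simp_rw [hpt] at this
  rw [integral_finsetSum _ fun k _ => (memLp_integrable_abs_rpow hα (hg k)).const_mul _] at this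
  simp_rw [integral_const_mul] at this
  rw [← this]
  congr with ω
  rw [mul_comm Complex.I, PiLp.inner_apply]
  simp

/-- Reflection: if `f = g j` on the support of `g j`, and the `g i` are disjointly supported, then
changing the sign of the `I (g i)`, `i ≠ j`, and of `I f - I (g j)` preserves the joint law. -/
lemma map_reflect (hI : IsStableIntegral P α I) [IsProbabilityMeasure P]
    {n : ℕ} {g : Fin n → ℝ → ℝ} (hg : ∀ k, MemLp (g k) (ENNReal.ofReal α) volume)
    {f : ℝ → ℝ} (hf : MemLp f (ENNReal.ofReal α) volume)
    (hdisj : ∀ x i j, i ≠ j → g i x = 0 ∨ g j x = 0) (j : Fin n)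
    (hfg : ∀ x, g j x = 0 ∨ g j x = f x) :
    P.map (fun ω (k : Option (Fin n)) => k.elim (I f ω) (fun i => I (g i) ω))
      = P.map (fun ω (k : Option (Fin n)) => k.elim (2 * I (g j) ω - I f ω)
          (fun i => if i = j then I (g i) ω else -I (g i) ω)) := by
  have hm := fun k => hI.measurable _ (hg k)
  have hmf := hI.measurable _ hf
  let F : Option (Fin n) → ℝ → ℝ := fun k => k.elim f g
  have hF : ∀ k, MemLp (F k) (ENNReal.ofReal α) volume := by
    rintro (_ | k)
    exacts [hf, hg k]
  refine map_eq_of_charFun_eq (Z := fun (k : Option (Fin n)) ω =>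
    k.elim (I f ω) (fun i => I (g i) ω)) (W := fun (k : Option (Fin n)) ω =>
      k.elim (2 * I (g j) ω - I f ω) (fun i => if i = j then I (g i) ω else -I (g i) ω))
    ?_ ?_ fun θ => ?_
  · rintro (_ | k)
    exacts [hmf, hm k]
  · rintro (_ | k)
    · exact ((hm j).const_mul 2).sub hmf
    · by_cases h : k = j
      · simpa [h] using hm j
      · simp only [Option.elim_some, if_neg h]
        exact (hm k).neg
  -- The reflection transposed to the coefficients.
  · let θ' : Option (Fin n) → ℝ := fun k => k.elim (-θ none)
      (fun i => if i = j then θ (some i) + 2 * θ none else -θ (some i))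
    have h1 := hI.charFun_fintype hF θ
    have h2 := hI.charFun_fintype hF θ'
    have hsum : ∀ v : Fin n → ℝ, ∑ i, θ' (some i) * v i
        = ∑ i, θ (some i) * (if i = j then v i else -v i) + 2 * θ none * v j := by
      intro v
      have : 2 * θ none * v j = ∑ i, if i = j then 2 * θ none * v i else 0 := by simp
      rw [this, ← Finset.sum_add_distrib]
      refine Finset.sum_congr rfl fun i _ => ?_
      simp only [θ', Option.elim_some]
      split_ifs <;> ring
    have e1 : ∀ ω, ∑ k, θ k * I (F k) ω
        = ∑ k : Option (Fin n), θ k * k.elim (I f ω) (fun i => I (g i) ω) := by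
      intro ω
      simp [Fintype.sum_option, F]
    have e2 : ∀ ω, ∑ k, θ' k * I (F k) ω
        = ∑ k : Option (Fin n), θ k * k.elim (2 * I (g j) ω - I f ω)
          (fun i => if i = j then I (g i) ω else -I (g i) ω) := by
      intro ω
      rw [Fintype.sum_option, Fintype.sum_option]
      simp only [F, Option.elim_some, Option.elim_none]
      rw [hsum (fun i => I (g i) ω)]
      simp only [θ', Option.elim_none]
      ring
    -- Where `g j` vanishes the whole sum changes sign; elsewhere `f = g j`, the other `g i` vanish
    -- and the sum is unchanged.
    have e3 : ∀ x, |∑ k, θ k * F k x| = |∑ k, θ' k * F k x| := by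
      intro x
      rw [Fintype.sum_option, Fintype.sum_option]
      simp only [F, Option.elim_some, Option.elim_none]
      rw [hsum (fun i => g i x)]
      simp only [θ', Option.elim_none]
      by_cases hj : g j x = 0
      · have : ∑ i, θ (some i) * (if i = j then g i x else -g i x)
            = -∑ i, θ (some i) * g i x := by
          rw [← Finset.sum_neg_distrib]
          refine Finset.sum_congr rfl fun i _ => ?_
          split_ifs with h
          · rw [h, hj]; ring
          · ring
        rw [this, hj, ← abs_neg]
        congr 1
        ring
      · have h0 : ∀ i, i ≠ j → g i x = 0 := fun i hi => (hdisj x i j hi).resolve_right hj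
        rw [Finset.sum_eq_single j (fun i _ hi => by rw [h0 i hi, mul_zero]) (by simp),
          Finset.sum_eq_single j (fun i _ hi => by rw [h0 i hi]; simp) (by simp),
          if_pos rfl, (hfg x).resolve_left hj]
        congr 1
        ring
    simp_rw [e1, e3] at h1
    simp_rw [e2] at h2
    rw [h1, h2]

/-- A maximal inequality: the maximum of the integrals of the restrictions of the `f k` to disjoint
sets is controlled by the maximum of the integrals of the `f k`. -/
lemma measureReal_exists_restrict_le (hI : IsStableIntegral P α I) [IsProbabilityMeasure P]
    {n : ℕ} {f g : Fin n → ℝ → ℝ} (hf : ∀ k, MemLp (f k) (ENNReal.ofReal α) volume)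
    (hg : ∀ k, MemLp (g k) (ENNReal.ofReal α) volume)
    (hdisj : ∀ x i j, i ≠ j → g i x = 0 ∨ g j x = 0)
    (hfg : ∀ k x, g k x = 0 ∨ g k x = f k x) (u : ℝ) :
    P {ω | ∃ k, u < |I (g k) ω|} ≤ 2 * P {ω | ∃ k, u < |I (f k) ω|} := by
  have hmg := fun k => hI.measurable _ (hg k)
  have hmf := fun k => hI.measurable _ (hf k)
  let B : Set Ω := {ω | ∃ k, u < |I (f k) ω|}
  have hB : MeasurableSet B := by
    have : B = ⋃ k, {ω | u < |I (f k) ω|} := by ext; simp [B]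
    rw [this]
    exact .iUnion fun k => measurableSet_lt (by fun_prop) (by fun_prop)
  -- Decomposition by the first index `j` at which `|I (g j)|` exceeds `u`; it ignores signs, so the
  -- reflection preserves it.
  let E : Fin n → Set Ω := fun j => {ω | u < |I (g j) ω| ∧ ∀ i < j, |I (g i) ω| ≤ u}
  have hE : ∀ j, MeasurableSet (E j) := fun j => by
    have : E j = {ω | u < |I (g j) ω|} ∩ ⋂ i, ⋂ (_ : i < j), {ω | |I (g i) ω| ≤ u} := by
      ext; simp [E]
    rw [this]
    exact (measurableSet_lt (by fun_prop) (by fun_prop)).inter (.iInter fun i => .iInter fun _ =>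
      measurableSet_le (by fun_prop) (by fun_prop))
  have hEd : Pairwise (Function.onFun Disjoint E) := by
    have : ∀ i j, i < j → Disjoint (E i) (E j) := fun i j hij =>
      Set.disjoint_left.2 fun ω h1 h2 => absurd h1.1 (not_lt.2 (h2.2 i hij))
    intro i j hij
    rcases lt_or_gt_of_ne hij with h | h
    exacts [this i j h, (this j i h).symm]
  have hEU : {ω | ∃ k, u < |I (g k) ω|} = ⋃ j, E j := by
    ext ω
    simp only [Set.mem_iUnion]
    constructor
    · intro h
      have hne : (Finset.univ.filter fun k => u < |I (g k) ω|).Nonempty := by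
        obtain ⟨k, hk⟩ := h
        exact ⟨k, by simpa using hk⟩
      refine ⟨Finset.min' _ hne, ?_, fun i hi => ?_⟩
      · simpa using Finset.min'_mem _ hne
      · by_contra h'
        exact absurd (Finset.min'_le _ i (by simpa using h')) (not_le.2 hi)
    · rintro ⟨j, hj, -⟩
      exact ⟨j, hj⟩
  have hstep : ∀ j, P (E j) ≤ 2 * P (E j ∩ B) := by
    intro j
    let S : Set (Option (Fin n) → ℝ) :=
      {v | u < |v (some j)| ∧ (∀ i < j, |v (some i)| ≤ u) ∧ u < |v none|}
    have hS : MeasurableSet S := by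
      have : S = {v | u < |v (some j)|} ∩ ((⋂ i, ⋂ (_ : i < j), {v | |v (some i)| ≤ u})
          ∩ {v | u < |v none|}) := by
        ext; simp [S]
      rw [this]
      exact (measurableSet_lt (by fun_prop) (by fun_prop)).inter
        ((MeasurableSet.iInter fun i => .iInter fun _ =>
          measurableSet_le (by fun_prop) (by fun_prop)).inter
          (measurableSet_lt (by fun_prop) (by fun_prop)))
    let V : Ω → Option (Fin n) → ℝ := fun ω k => k.elim (I (f j) ω) (fun i => I (g i) ω)
    let W : Ω → Option (Fin n) → ℝ := fun ω k => k.elim (2 * I (g j) ω - I (f j) ω)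
          (fun i => if i = j then I (g i) ω else -I (g i) ω)
    have hV : Measurable V := measurable_pi_lambda _ fun k => by
      rcases k with _ | k
      exacts [hmf j, hmg k]
    have hW : Measurable W := measurable_pi_lambda _ fun k => by
      rcases k with _ | k
      · exact ((hmg j).const_mul 2).sub (hmf j)
      · by_cases h : k = j
        · simpa [W, h] using hmg j
        · simp only [W, Option.elim_some, if_neg h]
          exact (hmg k).neg
    have hlaw : P (V ⁻¹' S) = P (W ⁻¹' S) := by
      rw [← Measure.map_apply hV hS, ← Measure.map_apply hW hS]
      exact congrArg (· S) (hI.map_reflect hg (hf j) hdisj j (hfg j))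
    -- As `2 I (g j)` is the sum of `I (f j)` and its reflection `2 I (g j) - I (f j)`, one of the
    -- two exceeds `u` in absolute value.
    have hcover : E j ⊆ V ⁻¹' S ∪ W ⁻¹' S := by
      intro ω hω
      by_cases h : u < |I (f j) ω|
      · exact .inl ⟨hω.1, hω.2, h⟩
      · refine .inr ⟨by simpa [W] using hω.1, fun i hi => by simpa [W, hi.ne] using hω.2 i hi, ?_⟩
        have h1 : |2 * I (g j) ω| ≤ |2 * I (g j) ω - I (f j) ω| + |I (f j) ω| := by
          simpa using abs_add_le (2 * I (g j) ω - I (f j) ω) (I (f j) ω)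
        rw [abs_mul, abs_two] at h1
        have h2 := hω.1
        have h3 := not_lt.1 h
        change u < |2 * I (g j) ω - I (f j) ω|
        linarith
    have hsub : V ⁻¹' S ⊆ E j ∩ B := fun ω hω => ⟨⟨hω.1, hω.2.1⟩, j, hω.2.2⟩
    calc P (E j) ≤ P (V ⁻¹' S) + P (W ⁻¹' S) := (measure_mono hcover).trans (measure_union_le _ _)
      _ = 2 * P (V ⁻¹' S) := by rw [← hlaw, two_mul]
      _ ≤ 2 * P (E j ∩ B) := by gcongr
  calc P {ω | ∃ k, u < |I (g k) ω|} = ∑ j, P (E j) := by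
        rw [hEU, measure_iUnion hEd hE, tsum_fintype]
    _ ≤ ∑ j, 2 * P (E j ∩ B) := Finset.sum_le_sum fun j _ => hstep j
    _ = 2 * P (⋃ j, E j ∩ B) := by
        rw [← Finset.mul_sum, measure_iUnion (fun i j hij => (hEd hij).mono
          Set.inter_subset_left Set.inter_subset_left) fun j => (hE j).inter hB, tsum_fintype]
    _ ≤ 2 * P B := by
        gcongr
        exact Set.iUnion_subset fun j => Set.inter_subset_right

end IsStableIntegral

/-! ### Almost sure unboundedness of stable integrals -/

namespace IsStableIntegral

variable {Ω : Type*} [MeasurableSpace Ω] {P : Measure Ω} {α : ℝ} {I : (ℝ → ℝ) → Ω → ℝ}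

/-- If the functions `f k` are unbounded at every point of a set of positive measure, then the
probability that some `I (f k)` exceeds `u` does not tend to zero as `u` grows. -/
lemma exists_le_measure_exists_abs_gt (hI : IsStableIntegral P α I) [IsProbabilityMeasure P]
    (hα : 0 < α) (hα2 : α < 2) {f : ℕ → ℝ → ℝ} (hfm : ∀ k, Measurable (f k))
    (hf : ∀ k, MemLp (f k) (ENNReal.ofReal α) volume) {U : Set ℝ} (hU : MeasurableSet U)
    (hU0 : volume U ≠ 0) (hUtop : volume U ≠ ⊤) (hunb : ∀ x ∈ U, ∀ R : ℝ, ∃ k, R < |f k x|) :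
    ∃ κ : ℝ, 0 < κ ∧ ∀ u : ℝ, 0 < u → κ ≤ P.real {ω | ∃ k, u < |I (f k) ω|} := by
  set v := volume.real U with hv
  have hvpos : 0 < v := ENNReal.toReal_pos hU0 hUtop
  -- The inner `v / 2` is the measure captured by finitely many pieces; the outer division by 2 pays
  -- for the maximal inequality.
  refine ⟨(1 - Real.exp (-(stableTailConst α * (1 - Real.exp (-(v / 2)))))) / 2, ?_,
    fun u hu => ?_⟩
  · have h1 : 0 < 1 - Real.exp (-(v / 2)) := sub_pos.2 (Real.exp_lt_one_iff.2 (by linarith))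
    have h2 := mul_pos (stableTailConst_pos α) h1
    exact half_pos (sub_pos.2 (Real.exp_lt_one_iff.2 (by linarith)))
  let B : ℕ → Set ℝ := fun j => U ∩ {x | u < |f j x|}
  have hB : ∀ j, MeasurableSet (B j) := fun j =>
    hU.inter (measurableSet_lt measurable_const (hfm j).abs)
  let A : ℕ → Set ℝ := disjointed B
  have hA : ∀ j, MeasurableSet (A j) := fun j => MeasurableSet.disjointed hB j
  have hAd : Pairwise (Function.onFun Disjoint A) := disjoint_disjointed B
  have hAB : ∀ j, A j ⊆ B j := fun j => disjointed_subset B j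
  have hAU : ⋃ j, A j = U := by
    rw [iUnion_disjointed]
    refine Set.Subset.antisymm (Set.iUnion_subset fun j => Set.inter_subset_left) fun x hx => ?_
    obtain ⟨k, hk⟩ := hunb x hx u
    exact Set.mem_iUnion.2 ⟨k, hx, hk⟩
  have hAfin : ∀ j, volume (A j) ≠ ⊤ := fun j =>
    measure_ne_top_of_subset ((hAB j).trans Set.inter_subset_left) hUtop
  obtain ⟨n, hn⟩ : ∃ n, v / 2 < ∑ j ∈ Finset.range n, volume.real (A j) := by
    have h1 := ENNReal.tendsto_nat_tsum fun j => volume (A j)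
    rw [← measure_iUnion hAd hA, hAU] at h1
    have h2 := (ENNReal.tendsto_toReal hUtop).comp h1
    obtain ⟨n, hn⟩ := (h2.eventually (lt_mem_nhds (half_lt_self hvpos))).exists
    refine ⟨n, ?_⟩
    simpa [ENNReal.toReal_sum fun j _ => hAfin j, measureReal_def, hv] using hn
  let g : Fin n → ℝ → ℝ := fun j => (A j).indicator (f j)
  have hg : ∀ j, MemLp (g j) (ENNReal.ofReal α) volume := fun j => (hf j).indicator (hA j)
  have hdisj : ∀ x i j, i ≠ j → g i x = 0 ∨ g j x = 0 := by
    intro x i j hij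
    by_cases hx : x ∈ A i
    · exact .inr (Set.indicator_of_notMem
        (Set.disjoint_left.1 (hAd (Fin.val_ne_of_ne hij)) hx) _)
    · exact .inl (Set.indicator_of_notMem hx _)
  have hfg : ∀ (j : Fin n) x, g j x = 0 ∨ g j x = f j x := fun j x =>
    Set.indicator_eq_zero_or_self (A j) (f j) x
  have hσ : ∀ j : Fin n, volume.real (A j) ≤ (∫ x, |g j x| ^ α) / u ^ α := by
    intro j
    have hupos : 0 < u ^ α := Real.rpow_pos_of_pos hu α
    rw [le_div_iff₀ hupos, ← smul_eq_mul, ← integral_indicator_const _ (hA j)]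
    refine integral_mono ((integrable_indicator_iff (hA j)).2
      (integrableOn_const (hAfin j))) (memLp_integrable_abs_rpow hα (hg j)) fun x => ?_
    by_cases hx : x ∈ A j
    · simp only [g, Set.indicator_of_mem hx]
      exact Real.rpow_le_rpow hu.le (hAB j hx).2.le hα.le
    · simp only [Set.indicator_of_notMem hx]
      positivity
  have hsum : v / 2 ≤ ∑ j : Fin n, (∫ x, |g j x| ^ α) / u ^ α := by
    rw [← Fin.sum_univ_eq_sum_range (fun j => volume.real (A j))] at hn
    exact hn.le.trans (Finset.sum_le_sum fun j _ => hσ j)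
  have h1 := measureReal_exists_abs_gt_ge (P := P) hα hα2 hu
    (fun j => integral_nonneg fun x => Real.rpow_nonneg (abs_nonneg (g j x)) α)
    (fun j => hI.measurable _ (hg j)) (hI.iIndepFun_of_disjoint hα hg hdisj)
    (fun j θ => hI.integral_cos (hg j) θ)
  have h2 := ENNReal.toReal_mono (by finiteness)
    (hI.measureReal_exists_restrict_le (fun k : Fin n => hf k) hg hdisj hfg u)
  rw [ENNReal.toReal_mul, ENNReal.toReal_ofNat] at h2
  have h3 : P.real {ω | ∃ k : Fin n, u < |I (f k) ω|} ≤ P.real {ω | ∃ k, u < |I (f k) ω|} :=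
    measureReal_mono fun ω ⟨k, hk⟩ => ⟨k, hk⟩
  have h4 : 1 - Real.exp (-(stableTailConst α * (1 - Real.exp (-(v / 2)))))
      ≤ 1 - Real.exp (-(stableTailConst α *
        (1 - Real.exp (-∑ j : Fin n, (∫ x, |g j x| ^ α) / u ^ α)))) := by
    have := stableTailConst_pos α
    gcongr
  simp only [measureReal_def] at *
  linarith

/-- If the functions `f k` are unbounded at every point of a set of positive measure, then the
sequence of stable integrals `I (f k)` is almost surely unbounded. -/
lemma measure_bounded_eq_zero (hI : IsStableIntegral P α I) [IsProbabilityMeasure P]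
    (hα : 0 < α) (hα2 : α < 2) {f : ℕ → ℝ → ℝ} (hfm : ∀ k, Measurable (f k))
    (hf : ∀ k, MemLp (f k) (ENNReal.ofReal α) volume) {U : Set ℝ} (hU : MeasurableSet U)
    (hU0 : volume U ≠ 0) (hUtop : volume U ≠ ⊤) (hunb : ∀ x ∈ U, ∀ R : ℝ, ∃ k, R < |f k x|) :
    P {ω | (fun k => I (f k) ω) ∈ boundedSeqs} = 0 := by
  have hX : Measurable (fun ω k => I (f k) ω) :=
    measurable_pi_lambda _ fun k => hI.measurable _ (hf k)
  refine (hI.measure_bounded_eq_zero_or_one hα hf).resolve_right fun h1 => ?_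
  obtain ⟨κ, hκ, hle⟩ :=
    hI.exists_le_measure_exists_abs_gt hα hα2 hfm hf hU hU0 hUtop hunb
  -- The shift by 1 keeps the level positive at `M = 0`. By continuity from above the intersection
  -- has probability at least `κ`, which excludes almost sure boundedness.
  let C : ℕ → Set Ω := fun M => {ω | ∃ k, ((M : ℝ) + 1) < |I (f k) ω|}
  have hC : ∀ M, MeasurableSet (C M) := fun M => by
    have : C M = ⋃ k, {ω | ((M : ℝ) + 1) < |I (f k) ω|} := by ext; simp [C]
    rw [this]
    exact .iUnion fun k => measurableSet_lt measurable_const (hI.measurable _ (hf k)).abs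
  have hanti : Antitone C := fun M N hMN ω ⟨k, hk⟩ =>
    ⟨k, lt_of_le_of_lt (by gcongr) hk⟩
  have hsub : ⋂ M, C M ⊆ {ω | (fun k => I (f k) ω) ∈ boundedSeqs}ᶜ := by
    rintro ω hω ⟨M, hM⟩
    obtain ⟨k, hk⟩ := Set.mem_iInter.1 hω M
    have := hM k
    linarith
  have hzero : P (⋂ M, C M) = 0 :=
    measure_mono_null hsub ((prob_compl_eq_zero_iff (hX measurableSet_boundedSeqs)).2 h1)
  have hlim := tendsto_measure_iInter_atTop (μ := P) (fun M => (hC M).nullMeasurableSet) hanti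
    ⟨0, measure_ne_top _ _⟩
  rw [hzero] at hlim
  have hlim' := (ENNReal.tendsto_toReal ENNReal.zero_ne_top).comp hlim
  exact absurd (ge_of_tendsto' hlim' fun M => hle ((M : ℝ) + 1) (by positivity))
    (not_le.2 (by simpa using hκ))

end IsStableIntegral

/-! ### Integrability and blow-up of the kernel -/

lemma measurable_posPartPow (γ : ℝ) : Measurable fun u => posPartPow u γ :=
  Measurable.ite measurableSet_Ioi (measurable_id.pow_const γ) measurable_const

lemma measurable_ltmfsmKernel (H : ℝ → ℝ) (α lam t : ℝ) : Measurable (ltmfsmKernel H α lam t) := by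
  have h := measurable_posPartPow (H t - 1 / α)
  unfold ltmfsmKernel
  exact ((by fun_prop : Measurable fun x : ℝ => Real.exp (-lam * max (t - x) 0)).mul
    (h.comp (measurable_const.sub measurable_id))).sub
    ((by fun_prop : Measurable fun x : ℝ => Real.exp (-lam * max (-x) 0)).mul
      (h.comp measurable_neg))

/-- The tempered power kernel `e^{-λ (t-x)_+} (t-x)_+ ^ (h - 1/α)` belongs to `L^α`. -/
lemma memLp_exp_mul_posPartPow {α lam h : ℝ} (hα : 0 < α) (hlam : 0 < lam) (hh : 0 < h) (t : ℝ) :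
    MemLp (fun x => Real.exp (-lam * max (t - x) 0) * posPartPow (t - x) (h - 1 / α))
      (ENNReal.ofReal α) volume := by
  have hm : Measurable fun x : ℝ =>
      Real.exp (-lam * max (t - x) 0) * posPartPow (t - x) (h - 1 / α) :=
    (by fun_prop : Measurable fun x : ℝ => Real.exp (-lam * max (t - x) 0)).mul
      ((measurable_posPartPow _).comp (measurable_const.sub measurable_id))
  rw [← integrable_norm_rpow_iff hm.aestronglyMeasurable (by simpa using hα) ENNReal.ofReal_ne_top,
    ENNReal.toReal_ofReal hα.le]
  -- With `y = t - x`, the `α`-th power of the kernel is the Gamma integrand `y^(h α - 1) e^(-lam α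
  -- y)`, integrable at 0 because `h α > 0`.
  have h1 := integrableOn_rpow_mul_exp_neg_mul_rpow (p := 1) (s := h * α - 1) (b := lam * α)
    (by nlinarith [mul_pos hh hα]) one_pos (mul_pos hlam hα)
  have h2 := ((integrable_indicator_iff measurableSet_Ioi).2 h1).comp_sub_left t
  refine h2.congr (.of_forall fun x => ?_)
  dsimp only
  by_cases hx : 0 < t - x
  · rw [Set.indicator_of_mem (Set.mem_Ioi.2 hx), posPartPow, if_pos hx, max_eq_left hx.le,
      Real.norm_of_nonneg (by positivity), Real.mul_rpow (by positivity) (by positivity),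
      ← Real.exp_mul, ← Real.rpow_mul hx.le, Real.rpow_one, mul_comm]
    congr 2
    · ring
    · field_simp
  · rw [Set.indicator_of_notMem (by simpa using hx), posPartPow, if_neg hx, mul_zero, norm_zero,
      Real.zero_rpow hα.ne']

lemma memLp_ltmfsmKernel {H : ℝ → ℝ} {α lam : ℝ} (hα : 0 < α) (hlam : 0 < lam)
    (t : ℝ) (hH : 0 < H t) : MemLp (ltmfsmKernel H α lam t) (ENNReal.ofReal α) volume := by
  have h := memLp_exp_mul_posPartPow hα hlam hH 0
  simp only [zero_sub] at h
  exact (memLp_exp_mul_posPartPow hα hlam hH t).sub h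

/-- The kernel blows up on the diagonal. -/
lemma tendsto_ltmfsmKernel_atTop {H : ℝ → ℝ} {α : ℝ} (lam : ℝ) (hα : 0 < α) {x : ℝ}
    (hHc : ContinuousAt H x) (hH : H x * α < 1) :
    Filter.Tendsto (fun t => ltmfsmKernel H α lam t x) (nhdsWithin x (Set.Ioi x)) Filter.atTop := by
  have hexp : Filter.Tendsto (fun t => H t - 1 / α) (nhdsWithin x (Set.Ioi x))
      (nhds (H x - 1 / α)) :=
    (hHc.tendsto.mono_left nhdsWithin_le_nhds).sub_const _
  have hneg : H x - 1 / α < 0 := by rw [sub_neg, lt_div_iff₀ hα]; exact hH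
  have hsub : Filter.Tendsto (fun t => t - x) (nhdsWithin x (Set.Ioi x))
      (nhdsWithin 0 (Set.Ioi 0)) := by
    refine tendsto_nhdsWithin_iff.2 ⟨?_, ?_⟩
    · have : ContinuousAt (fun t => t - x) x := by fun_prop
      simpa using this.tendsto.mono_left (nhdsWithin_le_nhds (s := Set.Ioi x))
    · filter_upwards [self_mem_nhdsWithin] with t ht
      exact sub_pos.2 (Set.mem_Ioi.1 ht)
  have hpow : Filter.Tendsto (fun t => posPartPow (t - x) (H t - 1 / α))
      (nhdsWithin x (Set.Ioi x)) Filter.atTop := by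
    -- The exponent varies with `t`, so the power is written `exp (γ(t) log (t - x))`, with `γ(t)`
    -- tending to a negative limit and the logarithm to `-∞`.
    have h1 := Real.tendsto_exp_atTop.comp
      (hexp.neg_mul_atBot hneg (Real.tendsto_log_nhdsGT_zero.comp hsub))
    refine h1.congr' ?_
    filter_upwards [self_mem_nhdsWithin] with t ht
    have ht' : 0 < t - x := sub_pos.2 ht
    simp only [Function.comp_apply, posPartPow, if_pos ht', Real.rpow_def_of_pos ht', mul_comm]
  have hone : Filter.Tendsto (fun t => Real.exp (-lam * max (t - x) 0))
      (nhdsWithin x (Set.Ioi x)) (nhds 1) := by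
    have : ContinuousAt (fun t => Real.exp (-lam * max (t - x) 0)) x := by fun_prop
    simpa using this.tendsto.mono_left (nhdsWithin_le_nhds (s := Set.Ioi x))
  have hsnd : Filter.Tendsto (fun t => Real.exp (-lam * max (-x) 0) * posPartPow (-x) (H t - 1 / α))
      (nhdsWithin x (Set.Ioi x))
      (nhds (Real.exp (-lam * max (-x) 0) * posPartPow (-x) (H x - 1 / α))) := by
    refine Filter.Tendsto.const_mul _ ?_
    unfold posPartPow
    split_ifs with hx
    · exact tendsto_const_nhds.rpow hexp (.inl hx.ne')
    · exact tendsto_const_nhds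
  have := (hone.pos_mul_atTop one_pos hpow).atTop_add hsnd.neg
  simpa only [ltmfsmKernel, sub_eq_add_neg] using this

/-! ### Transfer to the process `Y` -/

theorem proposition12
    {Ω : Type*} [MeasurableSpace Ω] (P : Measure Ω) [IsProbabilityMeasure P]
    {Ω' : Type*} [MeasurableSpace Ω'] (P' : Measure Ω') [IsProbabilityMeasure P']
    (a b α lam : ℝ) (ha : 0 < a) (hab : a ≤ b) (hb : b ≤ 2)
    (hα : 0 < α) (hα2 : α < 2) (hlam : 0 < lam)
    (H : ℝ → ℝ) (hHc : Continuous H) (hH : ∀ t, H t ∈ Set.Icc a b)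
    (hHα : ∀ t, H t * α < 1)
    (I : (ℝ → ℝ) → Ω → ℝ) (hI : IsStableIntegral P α I)
    (Y : ℝ → Ω' → ℝ) (hYver : IsVersion Y P' (ltmfsm I H α lam) P)
    (hYsep : IsSeparableProcess Y P')
    (c d : EReal) (hcd : c < d) :
    ∀ᵐ ω ∂P', (⨆ t ∈ {t : ℝ | c < (t : EReal) ∧ (t : EReal) < d},
      ENNReal.ofReal |Y t ω|) = ⊤ := by
  -- Real endpoints inside `(c, d)` give an interval of finite positive measure.
  obtain ⟨c', hc', hc'd⟩ := EReal.lt_iff_exists_real_btwn.1 hcd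
  obtain ⟨d', hcd', hd'⟩ := EReal.lt_iff_exists_real_btwn.1 hc'd
  have hlt : c' < d' := EReal.coe_lt_coe_iff.1 hcd'
  have : Nonempty (Set.Ioo c' d') := ⟨⟨(c' + d') / 2, by constructor <;> linarith⟩⟩
  obtain ⟨t, ht⟩ := TopologicalSpace.exists_dense_seq (Set.Ioo c' d')
  have hL : ∀ s, MemLp (ltmfsmKernel H α lam s) (ENNReal.ofReal α) volume := fun s =>
    memLp_ltmfsmKernel hα hlam s (ha.trans_le (hH s).1)
  have hunb : ∀ x ∈ Set.Ioo c' d', ∀ R : ℝ, ∃ k, R < |ltmfsmKernel H α lam (t k) x| := by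
    intro x hx R
    have h1 := (tendsto_ltmfsmKernel_atTop lam hα hHc.continuousAt (hHα x)).eventually_gt_atTop R
    obtain ⟨y, hy, hsub⟩ := (mem_nhdsGT_iff_exists_Ioo_subset' hx.2).1 h1
    have hy' : x < min y d' := lt_min hy hx.2
    -- Density supplies a time `t k` just to the right of `x`, where the kernel exceeds `R`.
    obtain ⟨k, hk⟩ := ht.exists_mem_open (s := Subtype.val ⁻¹' Set.Ioo x (min y d'))
      (isOpen_Ioo.preimage continuous_subtype_val)
      ⟨⟨(x + min y d') / 2, by linarith [hx.1], by linarith [min_le_right y d']⟩,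
        by constructor <;> dsimp only <;> linarith⟩
    exact ⟨k, (hsub ⟨hk.1, hk.2.trans_le (min_le_left _ _)⟩ : R < _).trans_le (le_abs_self _)⟩
  have hzero : P {ω | (fun k => ltmfsm I H α lam (t k) ω) ∈ boundedSeqs} = 0 :=
    hI.measure_bounded_eq_zero hα hα2 (fun k => measurable_ltmfsmKernel H α lam (t k))
      (fun k => hL (t k)) measurableSet_Ioo (by simpa using hlt) (by simp) hunb
  have hX : AEMeasurable (fun ω k => ltmfsm I H α lam (t k) ω) P :=
    (measurable_pi_lambda _ fun k => hI.measurable _ (hL (t k))).aemeasurable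
  have hY : AEMeasurable (fun ω k => Y (t k) ω) P' :=
    aemeasurable_pi_lambda _ fun k =>
      ((measurable_pi_apply (0 : Fin 1)).comp_aemeasurable
        (hYver 1 (fun _ => t k)).aemeasurable_fst)
  have hlaw : P'.map (fun ω k => Y (t k) ω) = P.map (fun ω k => ltmfsm I H α lam (t k) ω) := by
    have hlimX := isProjectiveLimit_map (X := fun (k : ℕ) ω => ltmfsm I H α lam (t k) ω) hX
    have hlimY := isProjectiveLimit_map (X := fun (k : ℕ) ω => Y (t k) ω) hY
    -- Both laws on sequences are projective limits of the same finite-dimensional laws.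
    refine hlimY.unique (fun J => (hlimX J).trans ?_)
    have e := Fintype.equivFin J
    have h := (hYver _ (fun i => t (e.symm i))).comp
      (u := fun (v : Fin (Fintype.card J) → ℝ) (j : J) => v (e j)) (by fun_prop)
    have h' := h.map_eq
    simp only [Function.comp_def, Equiv.symm_apply_apply] at h'
    exact h'.symm
  have hzero' : P' {ω | (fun k => Y (t k) ω) ∈ boundedSeqs} = 0 := by
    have h1 := Measure.map_apply_of_aemeasurable hY measurableSet_boundedSeqs
    rw [hlaw, Measure.map_apply_of_aemeasurable hX measurableSet_boundedSeqs] at h1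
    exact h1.symm.trans hzero
  filter_upwards [measure_eq_zero_iff_ae_notMem.1 hzero'] with ω hω
  by_contra hne
  refine hω ?_
  set s := ⨆ t ∈ {t : ℝ | c < (t : EReal) ∧ (t : EReal) < d}, ENNReal.ofReal |Y t ω| with hs
  refine ⟨⌈s.toReal⌉₊, fun k => le_trans ?_ (Nat.le_ceil _)⟩
  refine (ENNReal.ofReal_le_iff_le_toReal hne).1 ?_
  exact le_iSup₂ (f := fun (r : ℝ) (_ : r ∈ {r : ℝ | c < (r : EReal) ∧ (r : EReal) < d}) =>
    ENNReal.ofReal |Y r ω|) (t k : ℝ)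
    ⟨hc'.trans (EReal.coe_lt_coe_iff.2 (t k).2.1), (EReal.coe_lt_coe_iff.2 (t k).2.2).trans hd'⟩
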